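/- **Theorem (CRB for unbiased semi-blind channel estimators).** Let $L,M,N\ge 0$ be integers, $P=M+L$, $\gamma>0$, and let $F\in\mathbb C^{P\times M}$ be a precoding matrix of full rank $M$. For a vector $v=(v_0,\dots,v_{a-1})$ let $\mathcal T_v$ denote the Toeplitz (convolution) matrix with entries $(\mathcal T_v)_{ij}=v_{i-j}$ if $0\le i-j\le a-1$ and $0$ otherwise ($i,j$ counted from $0$). For a channel vector $h\in\mathbb C^{L+1}$ and a symbol vector $s\in\mathbb C^{MN}$ put $x=(I_N\otimes F)s\in\mathbb C^{PN}$; the receiver observes $$y=\sqrt\gamma\,\mathcal T_h x+n=\sqrt\gamma\,\mathcal T_h(I_N\otimes F)s+n\in\mathbb C^{PN+L},$$ where $n$ is a circularly-symmetric complex Gaussian vector with mean $0$ and covariance matrix $I_{PN+L}$; here $\mathcal T_h$ is $(PN+L)\times PN$ and, below, $\mathcal T_x$ is $(PN+L)\times(L+1)$. Let $A$ be a matrix with $MN$ columns and $c$ a vector (pilot constraint $As=c$). Let $U_n$ be a matrix whose columns form an orthonormal basis of the null space of $(I_N\otimes F)^H$, let $^\dagger$ denote the Moore–Penrose inverse,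 and let $$\Theta=\Big\{(h,x)\in\mathbb C^{L+1}\times\mathbb C^{PN}:\ Kx=\begin{bmatrix}0\\ c\end{bmatrix}\Big\},\qquad K=\begin{bmatrix}U_n^H\\ A(I_N\otimes F)^\dagger\end{bmatrix}.$$ A semi-blind channel estimator $\hat h(y)\in\mathbb C^{L+1}$ is called unbiased if, for every $(h,x)\in\Theta$, its expectation under the law of $y=\sqrt\gamma\,\mathcal T_hx+n$ exists and equals $h$. Let $\hat h$ be any unbiased semi-blind channel estimator. Let $h\in\mathbb C^{L+1}$ and let $s$ satisfy $As=c$, put $x=(I_N\otimes F)s$, and suppose that $\hat h$ has finite second moments under the law of $y$ at $(h,x)$. Let $\tilde E$ be a matrix whose columns form an orthonormal basis of $\ker K$, and $\tilde U$ a matrix whose columns form an orthonormal basis of the null space of $(\mathcal T_h\tilde E)^H$. Then $\mathcal T_x^H\tilde U\tilde U^H\mathcal T_x$ is invertible, and at $(h,x)$ $$\mathsf{cov}(\hat h)\ \ge\ \frac1\gamma\left(\mathcal T_x^H\tilde U\tilde U^H\mathcal T_x\right)^{-1},$$ where $\mathsf{cov}(\hat h)=\mathsf E\big[(\hat h-\mathsf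 E\hat h)(\hat h-\mathsf E\hat h)^H\big]$ and $B\ge C$ means that $B-C$ is Hermitian nonnegative-definite. -/

import Mathlib

open MeasureTheory ProbabilityTheory Matrix
open scoped Kronecker ComplexOrder

namespace SemiBlind

/-! ### The Moore-Penrose generalized inverse -/

/-- The four Penrose equations: `G` is a Moore-Penrose generalized inverse of `B`. -/
structure IsMoorePenrose {m n : Type*} [Fintype m] [Fintype n]
    (B : Matrix m n ℂ) (G : Matrix n m ℂ) : Prop where
  mul_mul_self : B * G * B = B
  mul_mul_inv : G * B * G = G
  isHermitian_left : (B * G)ᴴ = B * G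
  isHermitian_right : (G * B)ᴴ = G * B

theorem exists_hermitian_pinv {n : Type*} [Fintype n] [DecidableEq n] (H : Matrix n n ℂ)
    (hH : H.IsHermitian) :
    ∃ K : Matrix n n ℂ, Kᴴ = K ∧ H * K * H = H ∧ K * H * K = K ∧ K * H = H * K := by
  set U : Matrix n n ℂ := (hH.eigenvectorUnitary : Matrix n n ℂ) with hU
  have h1 : star U * U = 1 := Unitary.coe_star_mul_self hH.eigenvectorUnitary
  set D : Matrix n n ℂ := diagonal (fun i => (hH.eigenvalues i : ℂ)) with hD
  set D' : Matrix n n ℂ := diagonal (fun i => (hH.eigenvalues i : ℂ)⁻¹) with hD'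
  have hs : H = U * D * star U := by
    conv_lhs => rw [hH.spectral_theorem]
    rw [Unitary.conjStarAlgAut_apply]
    rfl
  have key : ∀ X Y : Matrix n n ℂ, (U * X * star U) * (U * Y * star U) = U * (X * Y) * star U := by
    intro X Y
    calc (U * X * star U) * (U * Y * star U) = U * X * (star U * U) * Y * star U := by
          simp only [Matrix.mul_assoc]
      _ = _ := by rw [h1]; simp only [Matrix.mul_one, Matrix.mul_assoc]
  refine ⟨U * D' * star U, ?_, ?_, ?_, ?_⟩
  · have hd : D'ᴴ = D' := by
      rw [hD', diagonal_conjTranspose]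
      congr 1
      funext i
      simp
    rw [star_eq_conjTranspose, conjTranspose_mul, conjTranspose_mul, hd,
      conjTranspose_conjTranspose, Matrix.mul_assoc]
  · rw [hs, key, key, hD, hD', diagonal_mul_diagonal, diagonal_mul_diagonal]
    congr 3
    funext i
    exact mul_inv_mul_cancel _
  · rw [hs, key, key, hD, hD', diagonal_mul_diagonal, diagonal_mul_diagonal]
    congr 3
    funext i
    by_cases h : (hH.eigenvalues i : ℂ) = 0
    · simp [h]
    · field_simp
  · rw [hs, key, key, hD, hD', diagonal_mul_diagonal, diagonal_mul_diagonal]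
    congr 3
    funext i
    exact mul_comm _ _

theorem exists_isMoorePenrose {m n : Type*} [Fintype m] [Fintype n] (B : Matrix m n ℂ) :
    ∃ G : Matrix n m ℂ, IsMoorePenrose B G := by
  classical
  obtain ⟨K, hK, h1, h2, h3⟩ := exists_hermitian_pinv (Bᴴ * B) (isHermitian_conjTranspose_mul_self B)
  refine ⟨K * Bᴴ, ?_, ?_, ?_, ?_⟩
  · have h0 : (Bᴴ * B) * (K * (Bᴴ * B) - 1) = 0 := by
      rw [Matrix.mul_sub, ← Matrix.mul_assoc, h1, Matrix.mul_one, sub_self]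
    have h4 : B * (K * (Bᴴ * B) - 1) = 0 := by
      rw [← conjTranspose_mul_self_eq_zero, conjTranspose_mul, Matrix.mul_assoc,
        ← Matrix.mul_assoc Bᴴ, h0, Matrix.mul_zero]
    rw [Matrix.mul_sub, Matrix.mul_one, sub_eq_zero] at h4
    rw [Matrix.mul_assoc, Matrix.mul_assoc]
    exact h4
  · calc K * Bᴴ * B * (K * Bᴴ) = K * (Bᴴ * B) * K * Bᴴ := by simp only [Matrix.mul_assoc]
      _ = _ := by rw [h2]
  · simp only [conjTranspose_mul, conjTranspose_conjTranspose, hK, Matrix.mul_assoc]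
  · rw [Matrix.mul_assoc, conjTranspose_mul, hK, conjTranspose_mul, conjTranspose_conjTranspose, h3]

/-- The Moore-Penrose generalized inverse `B†` of a complex matrix. -/
noncomputable def pinv {m n : Type*} [Fintype m] [Fintype n] (B : Matrix m n ℂ) : Matrix n m ℂ :=
  (exists_isMoorePenrose B).choose

theorem pinv_spec {m n : Type*} [Fintype m] [Fintype n] (B : Matrix m n ℂ) :
    IsMoorePenrose B (pinv B) :=
  (exists_isMoorePenrose B).choose_spec

/-! ### Matrices of the transmission model -/

/-- The columns of `B` form an orthonormal basis of the null space of `K`. -/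
def IsOrthonormalKerBasis {m n k : Type*} [Fintype m] [Fintype n] [Fintype k] [DecidableEq k]
    (K : Matrix m n ℂ) (B : Matrix n k ℂ) : Prop :=
  Bᴴ * B = 1 ∧ LinearMap.range B.mulVecLin = LinearMap.ker K.mulVecLin

/-- The banded Toeplitz (convolution) matrix `𝒯_v` with `rows` rows and `cols` columns: the
entry in row `i` and column `j` is `v (i - j)` if `0 ≤ i - j < a`, and `0` otherwise.  The full
convolution matrix of the text-book definition is the one with `rows = cols + a - 1`. -/
def toeplitz {a : ℕ} (v : Fin a → ℂ) (rows cols : ℕ) : Matrix (Fin rows) (Fin cols) ℂ :=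
  Matrix.of fun i j =>
    if hij : (j : ℕ) ≤ (i : ℕ) ∧ (i : ℕ) - (j : ℕ) < a then v ⟨(i : ℕ) - (j : ℕ), hij.2⟩ else 0

/-- The block precoder `I_N ⊗ F`; block `b`, position `p` has the linear index `p + b * P`. -/
def blockPrecoder {P M : ℕ} (N : ℕ) (F : Matrix (Fin P) (Fin M) ℂ) :
    Matrix (Fin (N * P)) (Fin (N * M)) ℂ :=
  Matrix.reindex finProdFinEquiv finProdFinEquiv ((1 : Matrix (Fin N) (Fin N) ℂ) ⊗ₖ F)

/-- The stacked constraint matrix `[Uₙᴴ ; A (I ⊗ F)†]` of the precoder and the pilots. -/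
noncomputable def constraintMatrix {P M N q r : ℕ} (F : Matrix (Fin P) (Fin M) ℂ)
    (Un : Matrix (Fin (N * P)) (Fin q) ℂ) (A : Matrix (Fin r) (Fin (N * M)) ℂ) :
    Matrix (Fin q ⊕ Fin r) (Fin (N * P)) ℂ :=
  Matrix.fromRows Unᴴ (A * pinv (blockPrecoder N F))

/-- The parameter set `Θ` of all pairs `(h, x)` of a channel vector `h` (unconstrained) and a
channel input `x` with `Uₙᴴ x = 0` and `A (I ⊗ F)† x = c`. -/
def parameterSet {L P M N q r : ℕ} (F : Matrix (Fin P) (Fin M) ℂ)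
    (Un : Matrix (Fin (N * P)) (Fin q) ℂ) (A : Matrix (Fin r) (Fin (N * M)) ℂ)
    (c : Fin r → ℂ) : Set ((Fin (L + 1) → ℂ) × (Fin (N * P) → ℂ)) :=
  {θ | constraintMatrix F Un A *ᵥ θ.2 = Sum.elim (0 : Fin q → ℂ) c}

/-! ### Noise, observation, estimators -/

/-- The circularly-symmetric complex Gaussian law on `ℂ` with mean `0` and variance `1`: real and
imaginary part are independent real Gaussians with mean `0` and variance `1 / 2`. -/
noncomputable def stdComplexGaussian : Measure ℂ :=
  ((gaussianReal 0 (1 / 2)).prod (gaussianReal 0 (1 / 2))).map Complex.measurableEquivRealProd.symm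

/-- The circularly-symmetric complex Gaussian law on `ℂᵈ` with mean `0` and covariance `I`. -/
noncomputable def awgn (d : ℕ) : Measure (Fin d → ℂ) :=
  Measure.pi fun _ => stdComplexGaussian

/-- The law of the observation `y = √γ 𝒯_h x + n`, where `n` is white Gaussian noise. -/
noncomputable def observationLaw {L K : ℕ} (γ : ℝ) (θ : (Fin (L + 1) → ℂ) × (Fin K → ℂ)) :
    Measure (Fin (K + L) → ℂ) :=
  (awgn (K + L)).map fun n => (Real.sqrt γ : ℂ) • (toeplitz θ.1 (K + L) K *ᵥ θ.2) + n

/-- `hhat` is an unbiased estimator of the channel vector: for every parameter `(h, x)` in `Θ` its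
expectation exists and is `h`. -/
def IsUnbiasedChannelEstimator {L K : ℕ} (γ : ℝ) (Θ : Set ((Fin (L + 1) → ℂ) × (Fin K → ℂ)))
    (hhat : (Fin (K + L) → ℂ) → (Fin (L + 1) → ℂ)) : Prop :=
  ∀ θ ∈ Θ, ∀ i, Integrable (fun y => hhat y i) (observationLaw γ θ) ∧
    ∫ y, hhat y i ∂(observationLaw γ θ) = θ.1 i

/-- The covariance matrix `E[(u - E u)(u - E u)ᴴ]` of a complex random vector `u`. -/
noncomputable def cov {Ω : Type*} [MeasurableSpace Ω] (μ : Measure Ω) {d : ℕ}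
    (u : Ω → Fin d → ℂ) : Matrix (Fin d) (Fin d) ℂ :=
  Matrix.of fun i j =>
    ∫ ω, (u ω i - ∫ ω', u ω' i ∂μ) * (starRingEnd ℂ) (u ω j - ∫ ω', u ω' j ∂μ) ∂μ

end SemiBlind

namespace SemiBlind

/-! ### The Cameron-Martin formula for white Gaussian noise -/

/-! The bound is a limit of Hammersley–Chapman–Robbins inequalities, so nothing is differentiated
under the integral and the estimator needs no regularity beyond its moments. The constraints are
affine over ℂ and leave `h` free, so for `K ξ = 0` the complex line `(h + w δ, x + w ξ)` stays in
`Θ`. Along it the noise-free observation moves by `√γ (w D + w² G)`, where `D = 𝒯_x δ + 𝒯_h ξ`,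
while unbiasedness moves the mean of `vᴴ ĥ` by exactly `w vᴴ δ`. A translate of the noise law has an
explicit square-integrable density, so Cauchy–Schwarz compares that change of mean with the variance
at the true point (`four_mul_sq_norm_le`). Letting `w → 0` gives `|vᴴ δ|² ≤ Var(vᴴ ĥ) · γ ‖D‖²`
(`sq_norm_le_of_integral_translate`, `sq_norm_le_of_direction`).

The nuisance direction `ξ = E α` is then chosen to minimise `‖D‖`: `D` becomes the projection of
`𝒯_x δ` onto the orthogonal complement of the range of `𝒯_h E`, of norm `‖Uᴴ 𝒯_x δ‖`. Optimising
over `δ` turns these scalar bounds into invertibility and the matrix inequality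
(`isUnit_and_posSemidef_of_sq_norm_le`). -/

theorem pi_withDensity_ofReal {ι : Type*} [Fintype ι] {α : ι → Type*}
    [∀ i, MeasurableSpace (α i)] (μ : ∀ i, Measure (α i)) [∀ i, SigmaFinite (μ i)]
    (f : ∀ i, α i → ℝ) (hf : ∀ i x, 0 ≤ f i x) (hfi : ∀ i, Integrable (f i) (μ i)) :
    (Measure.pi fun i => (μ i).withDensity fun x => ENNReal.ofReal (f i x)) =
      (Measure.pi μ).withDensity fun x => ENNReal.ofReal (∏ i, f i (x i)) := by
  have : ∀ i, IsFiniteMeasure ((μ i).withDensity fun x => ENNReal.ofReal (f i x)) := fun i =>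
    isFiniteMeasure_withDensity_ofReal (hfi i).2
  refine Measure.pi_eq fun s hs => ?_
  have hS : MeasurableSet (Set.univ.pi s) := MeasurableSet.univ_pi hs
  rw [withDensity_apply _ hS, Measure.restrict_pi_pi]
  rw [← ofReal_integral_eq_lintegral_ofReal
    (Integrable.fintype_prod_dep fun i => (hfi i).restrict)
    (Filter.Eventually.of_forall fun x => Finset.prod_nonneg fun i _ => hf i (x i))]
  rw [integral_fintype_prod_eq_prod, ENNReal.ofReal_prod_of_nonneg
    fun i _ => integral_nonneg (hf i)]
  refine Finset.prod_congr rfl fun i _ => ?_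
  rw [withDensity_apply _ (hs i), ofReal_integral_eq_lintegral_ofReal (hfi i).restrict
    (Filter.Eventually.of_forall (hf i))]

theorem withDensity_map_equiv {α β : Type*} [MeasurableSpace α] [MeasurableSpace β]
    (μ : Measure α) (e : α ≃ᵐ β) (f : β → ENNReal) :
    (μ.map e).withDensity f = (μ.withDensity (f ∘ e)).map e := by
  ext s hs
  rw [withDensity_apply _ hs, e.map_apply, withDensity_apply _ (e.measurable hs),
    e.restrict_map, lintegral_map_equiv]
  rfl

theorem gaussianReal_half_map_add (a : ℝ) :
    (gaussianReal 0 (1 / 2)).map (a + ·) =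
      (gaussianReal 0 (1 / 2)).withDensity fun x => ENNReal.ofReal (Real.exp (2 * a * x - a ^ 2)) := by
  have hv : (1 / 2 : NNReal) ≠ 0 := by norm_num
  rw [gaussianReal_map_const_add, gaussianReal_of_var_ne_zero _ hv, gaussianReal_of_var_ne_zero _ hv,
    ← withDensity_mul _ (measurable_gaussianPDF _ _) (by fun_prop)]
  congr 1
  funext x
  rw [Pi.mul_apply, gaussianPDF, gaussianPDF, ← ENNReal.ofReal_mul (gaussianPDFReal_nonneg _ _ _)]
  congr 1
  rw [gaussianPDFReal, gaussianPDFReal, mul_assoc (√_)⁻¹, ← Real.exp_add]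
  congr 2
  push_cast
  ring

/-- The density of the translate by `a` of the standard complex Gaussian law, with respect to that
law. -/
noncomputable def shiftDensity (a z : ℂ) : ℝ :=
  Real.exp (2 * (a.re * z.re + a.im * z.im) - Complex.normSq a)

theorem continuous_shiftDensity (a : ℂ) : Continuous (shiftDensity a) := by
  unfold shiftDensity
  fun_prop

theorem shiftDensity_pos (a z : ℂ) : 0 < shiftDensity a z := Real.exp_pos _

/-- Squaring the exponential doubles the shift, up to a constant. Square integrability and the
chi-square distance thus both follow from the fact that every such density has integral one. -/
theorem shiftDensity_sq (a z : ℂ) :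
    shiftDensity a z ^ 2 = Real.exp (2 * Complex.normSq a) * shiftDensity (2 * a) z := by
  rw [shiftDensity, shiftDensity, ← Real.exp_add, ← Real.exp_nat_mul]
  congr 1
  simp only [Complex.normSq_apply, Complex.mul_re, Complex.mul_im, Complex.re_ofNat,
    Complex.im_ofNat]
  push_cast
  ring

instance : IsProbabilityMeasure stdComplexGaussian := by
  unfold stdComplexGaussian
  exact Measure.isProbabilityMeasure_map (MeasurableEquiv.measurable _).aemeasurable

instance (d : ℕ) : IsProbabilityMeasure (awgn d) := by
  unfold awgn
  infer_instance

theorem stdComplexGaussian_map_add (a : ℂ) :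
    stdComplexGaussian.map (a + ·) =
      stdComplexGaussian.withDensity fun z => ENNReal.ofReal (shiftDensity a z) := by
  have hcomp : (a + ·) ∘ Complex.measurableEquivRealProd.symm =
      Complex.measurableEquivRealProd.symm ∘ Prod.map (a.re + ·) (a.im + ·) := by
    funext p
    apply Complex.ext <;> simp [Complex.measurableEquivRealProd]
  rw [stdComplexGaussian, Measure.map_map (by fun_prop) (MeasurableEquiv.measurable _), hcomp,
    ← Measure.map_map (MeasurableEquiv.measurable _) (by fun_prop),
    ← Measure.map_prod_map _ _ (by fun_prop) (by fun_prop), gaussianReal_half_map_add,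
    gaussianReal_half_map_add, prod_withDensity (by fun_prop) (by fun_prop),
    withDensity_map_equiv]
  congr 2
  funext p
  rw [← ENNReal.ofReal_mul (Real.exp_nonneg _), ← Real.exp_add]
  simp only [Function.comp, shiftDensity]
  congr 2
  simp [Complex.measurableEquivRealProd, Complex.normSq_apply]
  ring

theorem integrable_shiftDensity (a : ℂ) : Integrable (shiftDensity a) stdComplexGaussian := by
  refine ⟨(continuous_shiftDensity a).aestronglyMeasurable, ?_⟩
  rw [hasFiniteIntegral_iff_ofReal (Filter.Eventually.of_forall fun z => (shiftDensity_pos a z).le),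
    ← setLIntegral_univ, ← withDensity_apply _ MeasurableSet.univ, ← stdComplexGaussian_map_add]
  have : IsProbabilityMeasure (stdComplexGaussian.map (a + ·)) :=
    Measure.isProbabilityMeasure_map (by fun_prop)
  simp

/-- The density of the translate by `a` of the white Gaussian noise law. -/
noncomputable def noiseShiftDensity {d : ℕ} (a n : Fin d → ℂ) : ℝ :=
  ∏ i, shiftDensity (a i) (n i)

theorem continuous_noiseShiftDensity {d : ℕ} (a : Fin d → ℂ) :
    Continuous (noiseShiftDensity a) := by
  unfold noiseShiftDensity
  exact continuous_finsetProd _ fun i _ =>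
    (continuous_shiftDensity (a i)).comp (continuous_apply i)

theorem noiseShiftDensity_pos {d : ℕ} (a n : Fin d → ℂ) : 0 < noiseShiftDensity a n :=
  Finset.prod_pos fun _ _ => shiftDensity_pos _ _

theorem noiseShiftDensity_sq {d : ℕ} (a n : Fin d → ℂ) :
    noiseShiftDensity a n ^ 2 =
      Real.exp (2 * ∑ i, Complex.normSq (a i)) * noiseShiftDensity (2 * a) n := by
  simp only [noiseShiftDensity, ← Finset.prod_pow, shiftDensity_sq, Finset.prod_mul_distrib,
    Finset.mul_sum, Real.exp_sum]
  rfl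

theorem awgn_map_add {d : ℕ} (a : Fin d → ℂ) :
    (awgn d).map (a + ·) =
      (awgn d).withDensity fun n => ENNReal.ofReal (noiseShiftDensity a n) := by
  have h1 : ∀ i : Fin d, IsProbabilityMeasure (stdComplexGaussian.map (a i + ·)) := fun i =>
    Measure.isProbabilityMeasure_map (by fun_prop)
  unfold noiseShiftDensity awgn
  rw [← pi_withDensity_ofReal (fun _ => stdComplexGaussian) (fun i => shiftDensity (a i))
    (fun i x => (shiftDensity_pos _ _).le) (fun i => integrable_shiftDensity _)]
  simp only [← stdComplexGaussian_map_add]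
  exact Measure.pi_map_pi (f := fun i z => a i + z) (fun i => by fun_prop)

/-- Translation is a measurable equivalence and the density is finite, so `g` may be arbitrary; no
measurability of the estimator is needed. -/
theorem integrable_comp_add_iff {d : ℕ} (a : Fin d → ℂ) (g : (Fin d → ℂ) → ℂ) :
    Integrable (fun n => g (a + n)) (awgn d) ↔
      Integrable (fun n => (noiseShiftDensity a n : ℂ) * g n) (awgn d) := by
  have h := (MeasurableEquiv.addLeft a).measurableEmbedding.integrable_map_iff
    (μ := awgn d) (g := g)
  rw [MeasurableEquiv.coe_addLeft, awgn_map_add, integrable_withDensity_iff_integrable_smul'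
    (continuous_noiseShiftDensity a).measurable.ennreal_ofReal
    (Filter.Eventually.of_forall fun _ => ENNReal.ofReal_lt_top)] at h
  simpa only [ENNReal.toReal_ofReal (noiseShiftDensity_pos _ _).le, Complex.real_smul,
    Function.comp_def] using h.symm

theorem integral_comp_add {d : ℕ} (a : Fin d → ℂ) (g : (Fin d → ℂ) → ℂ) :
    ∫ n, g (a + n) ∂(awgn d) = ∫ n, (noiseShiftDensity a n : ℂ) * g n ∂(awgn d) := by
  have h := (MeasurableEquiv.addLeft a).measurableEmbedding.integral_map (μ := awgn d) g
  rw [MeasurableEquiv.coe_addLeft, awgn_map_add, integral_withDensity_eq_integral_toReal_smul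
    (continuous_noiseShiftDensity a).measurable.ennreal_ofReal
    (Filter.Eventually.of_forall fun _ => ENNReal.ofReal_lt_top)] at h
  simpa only [ENNReal.toReal_ofReal (noiseShiftDensity_pos _ _).le, Complex.real_smul] using h.symm

theorem integrable_noiseShiftDensity {d : ℕ} (a : Fin d → ℂ) :
    Integrable (noiseShiftDensity a) (awgn d) := by
  have h := (integrable_comp_add_iff a fun _ => 1).1 (integrable_const _)
  simpa using h.re

theorem integral_noiseShiftDensity {d : ℕ} (a : Fin d → ℂ) :
    ∫ n, noiseShiftDensity a n ∂(awgn d) = 1 := by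
  have h := integral_comp_add a fun _ => 1
  simp only [mul_one, integral_complex_ofReal] at h
  simpa using h.symm

theorem memLp_noiseShiftDensity {d : ℕ} (a : Fin d → ℂ) :
    MemLp (noiseShiftDensity a) 2 (awgn d) := by
  rw [memLp_two_iff_integrable_sq (continuous_noiseShiftDensity a).aestronglyMeasurable]
  simp only [noiseShiftDensity_sq]
  exact (integrable_noiseShiftDensity _).const_mul _

theorem integral_noiseShiftDensity_sub_one_sq {d : ℕ} (a : Fin d → ℂ) :
    ∫ n, (noiseShiftDensity a n - 1) ^ 2 ∂(awgn d) =
      Real.exp (2 * ∑ i, Complex.normSq (a i)) - 1 := by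
  have h : ∀ n, (noiseShiftDensity a n - 1) ^ 2 =
      Real.exp (2 * ∑ i, Complex.normSq (a i)) * noiseShiftDensity (2 * a) n -
        2 * noiseShiftDensity a n + 1 := fun n => by
    rw [← noiseShiftDensity_sq]; ring
  simp only [h]
  have hi := ((integrable_noiseShiftDensity (2 * a)).const_mul
    (Real.exp (2 * ∑ i, Complex.normSq (a i)))).sub ((integrable_noiseShiftDensity a).const_mul 2)
  simp only [Pi.sub_def] at hi
  rw [integral_add hi (integrable_const _), integral_sub ((integrable_noiseShiftDensity _).const_mul _)
      ((integrable_noiseShiftDensity _).const_mul _), integral_const_mul, integral_const_mul,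
    integral_noiseShiftDensity, integral_noiseShiftDensity]
  simp
  ring

/-! ### The information inequality for white Gaussian noise -/

theorem norm_integral_mul_sq_le {Ω : Type*} [MeasurableSpace Ω] {μ : Measure Ω} {f g : Ω → ℂ}
    (hf : MemLp f 2 μ) (hg : MemLp g 2 μ) :
    ‖∫ ω, f ω * g ω ∂μ‖ ^ 2 ≤ (∫ ω, ‖f ω‖ ^ 2 ∂μ) * ∫ ω, ‖g ω‖ ^ 2 ∂μ := by
  have h2 : ENNReal.ofReal 2 = 2 := by norm_num
  have h := integral_mul_norm_le_Lp_mul_Lq (μ := μ) (f := f) (g := g)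
    (Real.HolderConjugate.two_two) (by rwa [h2]) (by rwa [h2])
  have h0 : ‖∫ ω, f ω * g ω ∂μ‖ ≤ ∫ ω, ‖f ω‖ * ‖g ω‖ ∂μ := by
    simpa only [norm_mul] using norm_integral_le_integral_norm (μ := μ) fun ω => f ω * g ω
  have hA : 0 ≤ ∫ ω, ‖f ω‖ ^ 2 ∂μ := integral_nonneg fun _ => by positivity
  have hB : 0 ≤ ∫ ω, ‖g ω‖ ^ 2 ∂μ := integral_nonneg fun _ => by positivity
  simp only [Real.rpow_two, ← Real.sqrt_eq_rpow] at h
  calc _ ≤ (√(∫ ω, ‖f ω‖ ^ 2 ∂μ) * √(∫ ω, ‖g ω‖ ^ 2 ∂μ)) ^ 2 :=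
        pow_le_pow_left₀ (norm_nonneg _) (h0.trans h) 2
    _ = _ := by rw [mul_pow, Real.sq_sqrt hA, Real.sq_sqrt hB]

/-- Multiply `1 - x ≤ exp (-x)` by `exp x`. The explicit factor `x` allows `t²` to be cancelled
before the limit `t → 0`. -/
theorem exp_sub_one_le_mul_exp (x : ℝ) : Real.exp x - 1 ≤ x * Real.exp x := by
  have h := Real.add_one_le_exp (-x)
  have h1 : Real.exp (-x) * Real.exp x = 1 := by rw [← Real.exp_add]; simp
  nlinarith [Real.exp_pos x]

/-- If the mean of `X` under the noise law translated by `a` is `w`, and under the noise law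
translated by `b` is `i w`, then the second moment of `X` is bounded below. -/
theorem four_mul_sq_norm_le {d : ℕ} {X : (Fin d → ℂ) → ℂ} (hX : MemLp X 2 (awgn d))
    (h0 : ∫ n, X n ∂(awgn d) = 0) {a b : Fin d → ℂ} {w : ℂ}
    (ha : ∫ n, X (a + n) ∂(awgn d) = w) (hb : ∫ n, X (b + n) ∂(awgn d) = Complex.I * w) :
    4 * ‖w‖ ^ 2 ≤ (∫ n, ‖X n‖ ^ 2 ∂(awgn d)) *
      ((Real.exp (2 * ∑ i, Complex.normSq (a i)) - 1) +
        (Real.exp (2 * ∑ i, Complex.normSq (b i)) - 1)) := by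
  have hmem : ∀ c : Fin d → ℂ, MemLp (fun n => ((noiseShiftDensity c n - 1 : ℝ) : ℂ)) 2 (awgn d) :=
    fun c => ((memLp_noiseShiftDensity c).sub (memLp_const 1)).ofReal
  have hint : ∀ c : Fin d → ℂ, Integrable (fun n => X n * ((noiseShiftDensity c n - 1 : ℝ) : ℂ))
      (awgn d) := fun c => hX.integrable_mul (hmem c)
  -- Since `X` has mean zero, subtracting 1 from the density does not change the translated mean.
  have hmean : ∀ c : Fin d → ℂ, ∫ n, X n * ((noiseShiftDensity c n - 1 : ℝ) : ℂ) ∂(awgn d) =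
      ∫ n, X (c + n) ∂(awgn d) := fun c => by
    have hXi : Integrable X (awgn d) := hX.integrable (by norm_num)
    have hXc : Integrable (fun n => (noiseShiftDensity c n : ℂ) * X n) (awgn d) := by
      refine ((hint c).add hXi).congr (Filter.Eventually.of_forall fun n => ?_)
      simp only [Pi.add_apply, Complex.ofReal_sub, Complex.ofReal_one]
      ring
    rw [integral_comp_add, ← sub_zero (∫ n, _ * X n ∂(awgn d)), ← h0, ← integral_sub hXc hXi]
    refine integral_congr_ae (Filter.Eventually.of_forall fun n => ?_)
    simp only [Complex.ofReal_sub, Complex.ofReal_one]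
    ring
  -- The factor `-i` aligns the two means: `w - i (i w) = 2 w`. As the densities are real, `‖f‖²`
  -- has no cross term. A single real direction would lose a factor 2 in the limit.
  set f : (Fin d → ℂ) → ℂ := fun n => ((noiseShiftDensity a n - 1 : ℝ) : ℂ) -
    Complex.I * ((noiseShiftDensity b n - 1 : ℝ) : ℂ) with hf
  have hfm : MemLp f 2 (awgn d) := (hmem a).sub ((hmem b).const_mul _)
  have hXf : ∫ n, X n * f n ∂(awgn d) = 2 * w := by
    have h1 : ∀ n, X n * f n = X n * ((noiseShiftDensity a n - 1 : ℝ) : ℂ) -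
        Complex.I * (X n * ((noiseShiftDensity b n - 1 : ℝ) : ℂ)) := fun n => by
      simp only [hf]; ring
    simp only [h1]
    rw [integral_sub (hint a) ((hint b).const_mul _), integral_const_mul, hmean, hmean, ha, hb,
      ← mul_assoc, Complex.I_mul_I]
    ring
  have hff : ∫ n, ‖f n‖ ^ 2 ∂(awgn d) = (Real.exp (2 * ∑ i, Complex.normSq (a i)) - 1) +
      (Real.exp (2 * ∑ i, Complex.normSq (b i)) - 1) := by
    have h1 : ∀ n, ‖f n‖ ^ 2 = (noiseShiftDensity a n - 1) ^ 2 + (noiseShiftDensity b n - 1) ^ 2 :=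
      fun n => by
        rw [← Complex.normSq_eq_norm_sq, Complex.normSq_apply]
        simp [hf]
        ring
    have h2 : ∀ c : Fin d → ℂ, Integrable (fun n => (noiseShiftDensity c n - 1) ^ 2) (awgn d) :=
      fun c => ((memLp_noiseShiftDensity c).sub (memLp_const 1)).integrable_sq
    simp only [h1]
    rw [integral_add (h2 a) (h2 b), integral_noiseShiftDensity_sub_one_sq,
      integral_noiseShiftDensity_sub_one_sq]
  have h := norm_integral_mul_sq_le hX hfm
  rw [hXf, hff, norm_mul, mul_pow] at h
  norm_num at h
  linarith

theorem sum_normSq_quadratic {d : ℕ} (w : ℂ) (D G : Fin d → ℂ) :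
    ∑ i, Complex.normSq ((w • D + w ^ 2 • G) i) =
      Complex.normSq w * ∑ i, Complex.normSq (D i + w * G i) := by
  rw [Finset.mul_sum]
  refine Finset.sum_congr rfl fun i _ => ?_
  rw [← Complex.normSq_mul]
  congr 1
  simp only [Pi.add_apply, Pi.smul_apply, smul_eq_mul]
  ring

/-- Compare the translates for `w = t` and `w = i t`, divide by `t²` and let the real number `t`
tend to 0; the second-order term `G` disappears. -/
theorem sq_norm_le_of_integral_translate {d : ℕ} {X : (Fin d → ℂ) → ℂ} (hX : MemLp X 2 (awgn d))
    (D G : Fin d → ℂ) (z : ℂ)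
    (hmean : ∀ w : ℂ, ∫ n, X ((w • D + w ^ 2 • G) + n) ∂(awgn d) = w * z) :
    ‖z‖ ^ 2 ≤ (∫ n, ‖X n‖ ^ 2 ∂(awgn d)) * ∑ i, Complex.normSq (D i) := by
  set V := ∫ n, ‖X n‖ ^ 2 ∂(awgn d) with hV
  have hV0 : 0 ≤ V := integral_nonneg fun _ => by positivity
  have h0 : ∫ n, X n ∂(awgn d) = 0 := by simpa using hmean 0
  set p : ℂ → ℝ := fun w => ∑ i, Complex.normSq (D i + w * G i) with hp
  have hpc : Continuous p := continuous_finsetSum _ fun i _ => by fun_prop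
  -- This is the upper bound after cancelling `t²`. It is continuous also at 0, where it equals `V *
  -- p 0`, the claimed right-hand side.
  set R : ℝ → ℝ := fun t => V * ((p t * Real.exp (2 * (t ^ 2 * p t)) +
    p (t * Complex.I) * Real.exp (2 * (t ^ 2 * p (t * Complex.I)))) / 2) with hR
  have hRc : Continuous R := by
    have h1 : Continuous fun t : ℝ => p t := hpc.comp Complex.continuous_ofReal
    have h2 : Continuous fun t : ℝ => p (t * Complex.I) :=
      hpc.comp (Complex.continuous_ofReal.mul continuous_const)
    fun_prop
  have hle : ∀ t : ℝ, t ≠ 0 → ‖z‖ ^ 2 ≤ R t := fun t ht => by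
    have ht2 : 0 < t ^ 2 := by positivity
    have h := four_mul_sq_norm_le hX h0 (hmean t)
      ((hmean (t * Complex.I)).trans (by ring : _ = Complex.I * (t * z)))
    rw [sum_normSq_quadratic, sum_normSq_quadratic, norm_mul, mul_pow] at h
    simp only [Complex.normSq_mul, Complex.normSq_ofReal, Complex.normSq_I, mul_one,
      Complex.norm_real, Real.norm_eq_abs, sq_abs, ← pow_two] at h
    have h1 := exp_sub_one_le_mul_exp (2 * (t ^ 2 * p t))
    have h2 := exp_sub_one_le_mul_exp (2 * (t ^ 2 * p (t * Complex.I)))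
    have h3 := h.trans (mul_le_mul_of_nonneg_left (add_le_add h1 h2) hV0)
    have h4 : t ^ 2 * ‖z‖ ^ 2 ≤ t ^ 2 * R t := by
      simp only [hR]
      linarith
    exact le_of_mul_le_mul_left h4 ht2
  have hlim : Filter.Tendsto R (nhdsWithin 0 {0}ᶜ) (nhds (R 0)) :=
    hRc.continuousAt.tendsto.mono_left nhdsWithin_le_nhds
  have h := ge_of_tendsto hlim (eventually_nhdsWithin_of_forall hle)
  simpa [hR, hp] using h

/-! ### Covariance matrices -/

theorem cov_isHermitian {Ω : Type*} [MeasurableSpace Ω] (μ : Measure Ω) {d : ℕ}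
    (u : Ω → Fin d → ℂ) : (cov μ u).IsHermitian := by
  ext i j
  simp only [conjTranspose_apply, cov, of_apply]
  rw [← starRingEnd_apply, ← integral_conj]
  refine integral_congr_ae (Filter.Eventually.of_forall fun ω => ?_)
  simp only [map_mul, Complex.conj_conj]
  ring

/-- Reduces the matrix bound to scalar statistics `vᴴ u`, to which the information inequality
applies. -/
theorem star_dotProduct_cov_mulVec {Ω : Type*} [MeasurableSpace Ω] {μ : Measure Ω}
    [IsFiniteMeasure μ] {d : ℕ} {u : Ω → Fin d → ℂ} (hu : ∀ i, MemLp (fun ω => u ω i) 2 μ)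
    (v : Fin d → ℂ) :
    star v ⬝ᵥ (cov μ u *ᵥ v) =
      ((∫ ω, ‖∑ i, star (v i) * (u ω i - ∫ ω', u ω' i ∂μ)‖ ^ 2 ∂μ : ℝ) : ℂ) := by
  have hc : ∀ i, MemLp (fun ω => u ω i - ∫ ω', u ω' i ∂μ) 2 μ := fun i =>
    (hu i).sub (memLp_const _)
  have hprod : ∀ i j, Integrable (fun ω => (u ω i - ∫ ω', u ω' i ∂μ) *
      (starRingEnd ℂ) (u ω j - ∫ ω', u ω' j ∂μ)) μ := fun i j =>
    (hc i).integrable_mul (hc j).star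
  rw [← integral_complex_ofReal]
  have hsq : ∀ ω, ((‖∑ i, star (v i) * (u ω i - ∫ ω', u ω' i ∂μ)‖ ^ 2 : ℝ) : ℂ) =
      ∑ i, ∑ j, star (v i) * v j * ((u ω i - ∫ ω', u ω' i ∂μ) *
        (starRingEnd ℂ) (u ω j - ∫ ω', u ω' j ∂μ)) := fun ω => by
    rw [Complex.ofReal_pow, ← Complex.mul_conj', map_sum, Finset.sum_mul_sum]
    refine Finset.sum_congr rfl fun i _ => Finset.sum_congr rfl fun j _ => ?_
    rw [map_mul, starRingEnd_apply (star (v j)), star_star]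
    ring
  simp only [hsq]
  rw [integral_finsetSum _ fun i _ => integrable_finsetSum _ fun j _ => (hprod i j).const_mul _]
  simp only [dotProduct, mulVec, Finset.mul_sum, Pi.star_apply]
  refine Finset.sum_congr rfl fun i _ => ?_
  rw [integral_finsetSum _ fun j _ => (hprod i j).const_mul _]
  refine Finset.sum_congr rfl fun j _ => ?_
  rw [integral_const_mul, cov, of_apply]
  ring

/-! ### Toeplitz matrices and the precoder -/

theorem toeplitz_mulVec_apply {a rows cols : ℕ} (v : Fin a → ℂ) (w : Fin cols → ℂ)
    (i : Fin rows) :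
    (toeplitz v rows cols *ᵥ w) i =
      ∑ j : Fin cols, ∑ k : Fin a, if (k : ℕ) + j = i then v k * w j else 0 := by
  simp only [mulVec, dotProduct, toeplitz, of_apply]
  refine Finset.sum_congr rfl fun j _ => ?_
  split_ifs with h
  · rw [Finset.sum_eq_single (⟨(i : ℕ) - j, h.2⟩ : Fin a)]
    · rw [if_pos (Nat.sub_add_cancel h.1)]
    · intro k _ hk
      rw [if_neg]
      intro hk'
      exact hk (Fin.ext (by simp only; omega))
    · simp
  · rw [zero_mul, Finset.sum_eq_zero]
    intro k _
    rw [if_neg]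
    have := k.2
    omega

/-- Commutativity of convolution: it makes the output linear in the channel as well, and is the
source of `𝒯_x` in the bound. -/
theorem toeplitz_mulVec_comm {a b : ℕ} (rows : ℕ) (v : Fin a → ℂ) (w : Fin b → ℂ) :
    toeplitz v rows b *ᵥ w = toeplitz w rows a *ᵥ v := by
  funext i
  rw [toeplitz_mulVec_apply, toeplitz_mulVec_apply, Finset.sum_comm]
  simp only [mul_comm (v _), add_comm (_ : ℕ)]

theorem toeplitz_add_smul_mulVec {a b : ℕ} (rows : ℕ) (v v' : Fin a → ℂ) (w w' : Fin b → ℂ)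
    (t : ℂ) :
    toeplitz (v + t • v') rows b *ᵥ (w + t • w') = toeplitz v rows b *ᵥ w +
      (t • (toeplitz w rows a *ᵥ v' + toeplitz v rows b *ᵥ w') +
        t ^ 2 • (toeplitz v' rows b *ᵥ w')) := by
  have h : ∀ u : Fin b → ℂ, toeplitz (v + t • v') rows b *ᵥ u =
      toeplitz v rows b *ᵥ u + t • (toeplitz v' rows b *ᵥ u) := fun u => by
    rw [toeplitz_mulVec_comm, mulVec_add, mulVec_smul, toeplitz_mulVec_comm rows u v,
      toeplitz_mulVec_comm rows u v']
  rw [h, mulVec_add, mulVec_add, mulVec_smul, mulVec_smul, toeplitz_mulVec_comm rows v' w]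
  module

theorem pinv_mul_of_left_inverse {m n : Type*} [Fintype m] [Fintype n] [DecidableEq n]
    {B : Matrix m n ℂ} {G : Matrix n m ℂ} (h : G * B = 1) : pinv B * B = 1 := by
  calc pinv B * B = G * (B * pinv B * B) := by
        rw [Matrix.mul_assoc B, ← Matrix.mul_assoc G, h, Matrix.one_mul]
    _ = 1 := by rw [(pinv_spec B).mul_mul_self, h]

theorem exists_left_inverse_of_rank_eq {P M : ℕ} {F : Matrix (Fin P) (Fin M) ℂ}
    (hF : F.rank = M) : ∃ G : Matrix (Fin M) (Fin P) ℂ, G * F = 1 := by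
  have hcols : LinearIndependent ℂ F.col := by
    rw [linearIndependent_iff_card_eq_finrank_span, Fintype.card_fin, Set.finrank,
      ← rank_eq_finrank_span_cols, hF]
  have hinj : Function.Injective F.mulVec := mulVec_injective_iff.2 hcols
  refine ⟨pinv F, ext_of_mulVec_single fun j => hinj ?_⟩
  rw [mulVec_mulVec, mulVec_mulVec, ← Matrix.mul_assoc, (pinv_spec F).mul_mul_self, Matrix.mul_one]

/-- Full column rank gives `F` a left inverse `G`, and `I ⊗ G` is one for `I ⊗ F`. Hence the pilot
constraint on `x` recovers `A s`. -/
theorem pinv_blockPrecoder_mul {P M : ℕ} (N : ℕ) {F : Matrix (Fin P) (Fin M) ℂ}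
    (hF : F.rank = M) : pinv (blockPrecoder N F) * blockPrecoder N F = 1 := by
  obtain ⟨G, hG⟩ := exists_left_inverse_of_rank_eq hF
  refine pinv_mul_of_left_inverse (G := blockPrecoder N G) ?_
  simp only [blockPrecoder, reindex_apply]
  rw [submatrix_mul_equiv, ← mul_kronecker_mul, hG, Matrix.one_mul, one_kronecker_one,
    submatrix_one_equiv]

/-! ### Orthonormal bases of null spaces -/

theorem IsOrthonormalKerBasis.mul_eq_zero {m n k : Type*} [Fintype m] [Fintype n] [Fintype k]
    [DecidableEq k] {K : Matrix m n ℂ} {B : Matrix n k ℂ} (h : IsOrthonormalKerBasis K B) :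
    K * B = 0 := by
  refine ext_of_mulVec_single fun j => ?_
  have hj : B.mulVecLin (Pi.single j 1) ∈ LinearMap.ker K.mulVecLin := by
    rw [← h.2]
    exact LinearMap.mem_range_self _ _
  rw [← mulVec_mulVec, zero_mulVec]
  simpa using hj

/-- The orthogonal projection onto the null space of `Bᴴ` is obtained by adding an element of the
column space of `B`. -/
theorem IsOrthonormalKerBasis.exists_add_mulVec {m k l : Type*} [Fintype m] [Fintype k]
    [Fintype l] [DecidableEq l] {B : Matrix m k ℂ} {U : Matrix m l ℂ}
    (h : IsOrthonormalKerBasis Bᴴ U) (y : m → ℂ) :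
    ∃ α : k → ℂ, y + B *ᵥ α = U *ᵥ (Uᴴ *ᵥ y) := by
  classical
  -- `B B†` is the orthogonal projection onto the column space of `B`, so this removes that
  -- component of `y`.
  refine ⟨-(pinv B *ᵥ y), ?_⟩
  have hker : y + B *ᵥ (-(pinv B *ᵥ y)) ∈ LinearMap.ker Bᴴ.mulVecLin := by
    have h1 : Bᴴ * (B * pinv B) = Bᴴ := by
      rw [← (pinv_spec B).isHermitian_left, ← conjTranspose_mul, (pinv_spec B).mul_mul_self]
    rw [LinearMap.mem_ker, mulVecLin_apply, mulVec_neg, mulVec_add, mulVec_neg, mulVec_mulVec,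
      mulVec_mulVec, Matrix.mul_assoc, h1, add_neg_cancel]
  have hUB : Uᴴ * B = 0 := by
    rw [← conjTranspose_conjTranspose B, ← conjTranspose_mul, h.mul_eq_zero, conjTranspose_zero]
  rw [← h.2] at hker
  obtain ⟨β, hβ⟩ := hker
  rw [mulVecLin_apply] at hβ
  have hβ' : β = Uᴴ *ᵥ y := by
    rw [← one_mulVec β, ← h.1, ← mulVec_mulVec, hβ, mulVec_add, mulVec_mulVec, hUB, zero_mulVec,
      add_zero]
  rw [← hβ, hβ']

theorem star_dotProduct_self_eq {n : Type*} [Fintype n] (v : n → ℂ) :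
    star v ⬝ᵥ v = ((∑ i, Complex.normSq (v i) : ℝ) : ℂ) := by
  simp only [dotProduct, Complex.ofReal_sum, Complex.normSq_eq_conj_mul_self]
  rfl

theorem sum_normSq_mulVec_of_isometry {m l : Type*} [Fintype m] [Fintype l] [DecidableEq l]
    {U : Matrix m l ℂ} (hU : Uᴴ * U = 1) (β : l → ℂ) :
    ∑ i, Complex.normSq ((U *ᵥ β) i) = ∑ i, Complex.normSq (β i) := by
  apply Complex.ofReal_injective
  rw [← star_dotProduct_self_eq, ← star_dotProduct_self_eq, star_mulVec, ← dotProduct_mulVec,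
    mulVec_mulVec, hU, one_mulVec]

/-! ### From quadratic bounds to a matrix inequality -/

/-- Taking `v = δ` in the bound forces `δ = 0` whenever `W δ = 0`, hence invertibility. The matrix
inequality tests each `v` against the extremal `δ = (Wᴴ W)⁻¹ v`. -/
theorem isUnit_and_posSemidef_of_sq_norm_le {n l : Type*} [Fintype n] [DecidableEq n] [Fintype l]
    {C : Matrix n n ℂ} (hC : C.IsHermitian) {W : Matrix l n ℂ} {γ : ℝ} (hγ : 0 < γ)
    {Q : (n → ℂ) → ℝ} (hQ : ∀ v, star v ⬝ᵥ (C *ᵥ v) = (Q v : ℂ))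
    (hle : ∀ v δ : n → ℂ, ‖star v ⬝ᵥ δ‖ ^ 2 ≤ Q v * (γ * ∑ i, Complex.normSq ((W *ᵥ δ) i))) :
    IsUnit (Wᴴ * W) ∧ (C - ((1 / γ : ℝ) : ℂ) • (Wᴴ * W)⁻¹).PosSemidef := by
  have hform : ∀ δ : n → ℂ, star δ ⬝ᵥ ((Wᴴ * W) *ᵥ δ) =
      ((∑ i, Complex.normSq ((W *ᵥ δ) i) : ℝ) : ℂ) := fun δ => by
    rw [← star_dotProduct_self_eq, star_mulVec, ← mulVec_mulVec, dotProduct_mulVec]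
  have hzero : ∀ δ : n → ℂ, ∑ i, Complex.normSq ((W *ᵥ δ) i) = 0 → δ = 0 := fun δ hδ => by
    have h := hle δ δ
    rw [hδ, mul_zero, mul_zero] at h
    have h1 : star δ ⬝ᵥ δ = 0 := norm_eq_zero.1 (pow_eq_zero_iff two_ne_zero |>.1
      (le_antisymm h (by positivity)))
    exact dotProduct_star_self_eq_zero.1 h1
  have hunit : IsUnit (Wᴴ * W) := by
    rw [← mulVec_injective_iff_isUnit]
    intro δ₁ δ₂ h12
    rw [← sub_eq_zero]
    apply hzero
    have h := hform (δ₁ - δ₂)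
    rw [mulVec_sub, sub_eq_zero.2 h12, dotProduct_zero] at h
    exact_mod_cast h.symm
  refine ⟨hunit, ?_⟩
  have hJ : (Wᴴ * W)⁻¹.IsHermitian := (isHermitian_conjTranspose_mul_self W).inv
  refine PosSemidef.of_dotProduct_mulVec_nonneg
    (hC.sub (hJ.smul (Complex.conj_ofReal _))) fun v => ?_
  set δ := (Wᴴ * W)⁻¹ *ᵥ v with hδ
  set S := ∑ i, Complex.normSq ((W *ᵥ δ) i) with hS
  have hJδ : (Wᴴ * W) *ᵥ δ = v := by
    rw [hδ, mulVec_mulVec, mul_nonsing_inv _ ((isUnit_iff_isUnit_det _).1 hunit), one_mulVec]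
  have hvδ : star v ⬝ᵥ δ = (S : ℂ) := by
    rw [← hform δ, dotProduct_mulVec (star δ), ← congrArg star hJδ, star_mulVec, conjTranspose_mul,
      conjTranspose_conjTranspose]
  have hS0 : 0 ≤ S := Finset.sum_nonneg fun _ _ => Complex.normSq_nonneg _
  have hQ0 : 0 ≤ γ * Q v - S := by
    -- For this `δ` both `vᴴ δ` and `‖W δ‖²` equal `S`, so the bound reads `S² ≤ γ Q(v) S`.
    -- Cancelling `S` needs `S > 0`; otherwise `v = 0`.
    rcases hS0.eq_or_lt with h0 | hpos
    · have hv : v = 0 := by rw [← hJδ, hzero δ h0.symm, mulVec_zero]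
      have hQv : (Q v : ℂ) = 0 := by rw [← hQ, hv, star_zero, zero_dotProduct]
      rw [Complex.ofReal_eq_zero] at hQv
      rw [← h0, hQv]
      simp
    · have h := hle v δ
      rw [hvδ, Complex.norm_real, Real.norm_eq_abs, sq_abs, ← hS] at h
      have h1 : S * S ≤ (γ * Q v) * S := by linarith
      linarith [le_of_mul_le_mul_right h1 hpos]
  rw [sub_mulVec, dotProduct_sub, hQ, smul_mulVec, dotProduct_smul, ← hδ, hvδ, smul_eq_mul,
    ← Complex.ofReal_mul, ← Complex.ofReal_sub, Complex.zero_le_real]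
  have h2 : Q v - 1 / γ * S = (γ * Q v - S) / γ := by field_simp
  rw [h2]
  positivity

/-! ### The bound along directions in the parameter set -/

theorem observationLaw_integral {L K : ℕ} (γ : ℝ) (θ : (Fin (L + 1) → ℂ) × (Fin K → ℂ))
    (g : (Fin (K + L) → ℂ) → ℂ) :
    ∫ y, g y ∂(observationLaw γ θ) =
      ∫ n, g ((Real.sqrt γ : ℂ) • (toeplitz θ.1 (K + L) K *ᵥ θ.2) + n) ∂(awgn (K + L)) :=
  (MeasurableEquiv.addLeft _).measurableEmbedding.integral_map (μ := awgn (K + L)) g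

theorem sq_norm_le_of_direction {L K : ℕ} {γ : ℝ} (hγ : 0 < γ)
    {Θ : Set ((Fin (L + 1) → ℂ) × (Fin K → ℂ))} {hhat : (Fin (K + L) → ℂ) → (Fin (L + 1) → ℂ)}
    (hunb : IsUnbiasedChannelEstimator γ Θ hhat) {h : Fin (L + 1) → ℂ} {x : Fin K → ℂ}
    (hL2 : ∀ i, MemLp (fun y => hhat y i) 2 (observationLaw γ (h, x)))
    {δ : Fin (L + 1) → ℂ} {ξ : Fin K → ℂ} (hmem : ∀ w : ℂ, (h + w • δ, x + w • ξ) ∈ Θ)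
    (v : Fin (L + 1) → ℂ) :
    ‖star v ⬝ᵥ δ‖ ^ 2 ≤
      (∫ y, ‖∑ i, star (v i) * (hhat y i - ∫ y', hhat y' i ∂(observationLaw γ (h, x)))‖ ^ 2
        ∂(observationLaw γ (h, x))) *
      (γ * ∑ i, Complex.normSq
        ((toeplitz x (K + L) (L + 1) *ᵥ δ + toeplitz h (K + L) K *ᵥ ξ) i)) := by
  have hmem0 : (h, x) ∈ Θ := by simpa using hmem 0
  have hmean0 : ∀ i, ∫ y', hhat y' i ∂(observationLaw γ (h, x)) = h i := fun i =>
    (hunb _ hmem0 i).2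
  simp only [hmean0]
  set c : ℂ := (Real.sqrt γ : ℂ) with hc
  set m := c • (toeplitz h (K + L) K *ᵥ x) with hm
  set D := toeplitz x (K + L) (L + 1) *ᵥ δ + toeplitz h (K + L) K *ᵥ ξ with hD
  set G := toeplitz δ (K + L) K *ᵥ ξ with hG
  set Y : (Fin (K + L) → ℂ) → ℂ := fun y => ∑ i, star (v i) * (hhat y i - h i) with hY
  have hemb : MeasurableEmbedding fun n : Fin (K + L) → ℂ => m + n :=
    (MeasurableEquiv.addLeft m).measurableEmbedding
  have : IsProbabilityMeasure (observationLaw γ (h, x)) :=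
    Measure.isProbabilityMeasure_map hemb.measurable.aemeasurable
  have hYL2 : MemLp Y 2 (observationLaw γ (h, x)) :=
    memLp_finsetSum _ fun i _ => ((hL2 i).sub (memLp_const _)).const_mul _
  have hXL2 : MemLp (fun n => Y (m + n)) 2 (awgn (K + L)) :=
    hemb.memLp_map_measure_iff.1 hYL2
  -- The model is bilinear in channel and input, so the displacement is exactly quadratic in `w`,
  -- with no further remainder.
  have hshift : ∀ w : ℂ, c • (toeplitz (h + w • δ) (K + L) K *ᵥ (x + w • ξ)) =
      m + (w • c • D + w ^ 2 • c • G) := fun w => by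
    rw [toeplitz_add_smul_mulVec, hm]
    module
  have hmean : ∀ w : ℂ, ∫ n, Y (m + ((w • c • D + w ^ 2 • c • G) + n)) ∂(awgn (K + L)) =
      w * (star v ⬝ᵥ δ) := fun w => by
    have h1 := observationLaw_integral γ (h + w • δ, x + w • ξ) Y
    simp only [← hc, hshift] at h1
    simp only [← add_assoc] at h1 ⊢
    have hprob : IsProbabilityMeasure (observationLaw γ (h + w • δ, x + w • ξ)) :=
      Measure.isProbabilityMeasure_map (by fun_prop)
    have hint : ∀ i, Integrable (fun y => star (v i) * (hhat y i - h i))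
        (observationLaw γ (h + w • δ, x + w • ξ)) := fun i =>
      ((hunb _ (hmem w) i).1.sub (integrable_const _)).const_mul _
    rw [← h1]
    simp only [hY]
    rw [integral_finsetSum _ fun i _ => hint i]
    simp only [dotProduct, Finset.mul_sum]
    refine Finset.sum_congr rfl fun i _ => ?_
    rw [integral_const_mul, integral_sub (hunb _ (hmem w) i).1 (integrable_const _),
      (hunb _ (hmem w) i).2]
    simp
    ring
  have hmain := sq_norm_le_of_integral_translate hXL2 (c • D) (c • G) _ hmean
  have hV : ∫ y, ‖Y y‖ ^ 2 ∂(observationLaw γ (h, x)) =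
      ∫ n, ‖Y (m + n)‖ ^ 2 ∂(awgn (K + L)) := hemb.integral_map _
  have hnorm : ∑ i, Complex.normSq ((c • D) i) = γ * ∑ i, Complex.normSq (D i) := by
    simp only [Pi.smul_apply, smul_eq_mul, Complex.normSq_mul, hc, Complex.normSq_ofReal,
      Real.mul_self_sqrt hγ.le, Finset.mul_sum]
  rw [hV, ← hnorm]
  exact hmain

/-- The precoded symbols satisfy both constraints, and the columns of `E` lie in the kernel of the
constraint matrix. -/
theorem add_smul_mem_parameterSet {L M N q r k : ℕ} {F : Matrix (Fin (M + L)) (Fin M) ℂ}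
    (hF : F.rank = M) {Un : Matrix (Fin (N * (M + L))) (Fin q) ℂ}
    (hUn : IsOrthonormalKerBasis (blockPrecoder N F)ᴴ Un)
    {A : Matrix (Fin r) (Fin (N * M)) ℂ} {c : Fin r → ℂ} {s : Fin (N * M) → ℂ} (hs : A *ᵥ s = c)
    {E : Matrix (Fin (N * (M + L))) (Fin k) ℂ}
    (hE : IsOrthonormalKerBasis (constraintMatrix F Un A) E)
    (h : Fin (L + 1) → ℂ) (α : Fin k → ℂ) (w : ℂ) :
    (h, blockPrecoder N F *ᵥ s + w • (E *ᵥ α)) ∈ parameterSet F Un A c := by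
  have hUB : Unᴴ * blockPrecoder N F = 0 := by
    rw [← conjTranspose_conjTranspose (blockPrecoder N F), ← conjTranspose_mul, hUn.mul_eq_zero,
      conjTranspose_zero]
  change constraintMatrix F Un A *ᵥ (blockPrecoder N F *ᵥ s + w • (E *ᵥ α)) = _
  rw [mulVec_add, mulVec_smul, mulVec_mulVec _ _ E, hE.mul_eq_zero, zero_mulVec, smul_zero,
    add_zero, constraintMatrix, fromRows_mulVec, mulVec_mulVec, mulVec_mulVec, hUB,
    Matrix.mul_assoc, pinv_blockPrecoder_mul N hF, Matrix.mul_one, hs, zero_mulVec]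

end SemiBlind

theorem mainTheorem1 (L M N q r k l : ℕ) (γ : ℝ) (hγ : 0 < γ)
    -- a full-rank linear redundant precoder, with `P = M + L`
    (F : Matrix (Fin (M + L)) (Fin M) ℂ) (hF : F.rank = M)
    -- an orthonormal basis of the null space of `(I ⊗ F)ᴴ`
    (Un : Matrix (Fin (N * (M + L))) (Fin q) ℂ)
    (hUn : SemiBlind.IsOrthonormalKerBasis (SemiBlind.blockPrecoder N F)ᴴ Un)
    -- the pilot constraint `A s = c`
    (A : Matrix (Fin r) (Fin (N * M)) ℂ) (c : Fin r → ℂ)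
    -- the true channel, the true symbols and the resulting channel input
    (h : Fin (L + 1) → ℂ) (s : Fin (N * M) → ℂ) (hs : A *ᵥ s = c)
    (x : Fin (N * (M + L)) → ℂ) (hx : x = SemiBlind.blockPrecoder N F *ᵥ s)
    (E : Matrix (Fin (N * (M + L))) (Fin k) ℂ)
    (hE : SemiBlind.IsOrthonormalKerBasis (SemiBlind.constraintMatrix F Un A) E)
    (U : Matrix (Fin (N * (M + L) + L)) (Fin l) ℂ)
    (hU : SemiBlind.IsOrthonormalKerBasis
      (SemiBlind.toeplitz h (N * (M + L) + L) (N * (M + L)) * E)ᴴ U)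
    -- an unbiased estimator with finite second moments at the true parameter
    (hhat : (Fin (N * (M + L) + L) → ℂ) → (Fin (L + 1) → ℂ))
    (hunb : SemiBlind.IsUnbiasedChannelEstimator γ (SemiBlind.parameterSet F Un A c) hhat)
    (hL2 : ∀ i, MemLp (fun y => hhat y i) 2 (SemiBlind.observationLaw γ (h, x))) :
    IsUnit ((SemiBlind.toeplitz x (N * (M + L) + L) (L + 1))ᴴ * U * Uᴴ *
        SemiBlind.toeplitz x (N * (M + L) + L) (L + 1)) ∧
      (SemiBlind.cov (SemiBlind.observationLaw γ (h, x)) hhat -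
        ((1 / γ : ℝ) : ℂ) • ((SemiBlind.toeplitz x (N * (M + L) + L) (L + 1))ᴴ * U * Uᴴ *
          SemiBlind.toeplitz x (N * (M + L) + L) (L + 1))⁻¹).PosSemidef := by
  have hprob : IsProbabilityMeasure (SemiBlind.observationLaw γ (h, x)) :=
    Measure.isProbabilityMeasure_map (by fun_prop)
  set T := SemiBlind.toeplitz x (N * (M + L) + L) (L + 1) with hT
  have hW : Tᴴ * U * Uᴴ * T = (Uᴴ * T)ᴴ * (Uᴴ * T) := by
    rw [conjTranspose_mul, conjTranspose_conjTranspose]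
    simp only [Matrix.mul_assoc]
  rw [hW]
  refine SemiBlind.isUnit_and_posSemidef_of_sq_norm_le (SemiBlind.cov_isHermitian _ _) hγ
    (SemiBlind.star_dotProduct_cov_mulVec hL2) fun v δ => ?_
  -- The least favourable input perturbation `E α`: it cancels the part of `𝒯_x δ` that a change of
  -- `x` can imitate. What remains is `U Uᴴ 𝒯_x δ`, and the isometry `U` drops out of the norm.
  obtain ⟨α, hα⟩ := hU.exists_add_mulVec (T *ᵥ δ)
  have hbound := SemiBlind.sq_norm_le_of_direction hγ hunb hL2 (δ := δ) (ξ := E *ᵥ α)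
    (fun w => hx ▸ SemiBlind.add_smul_mem_parameterSet hF hUn hs hE _ α w) v
  rw [mulVec_mulVec _ _ E, ← hT, hα, SemiBlind.sum_normSq_mulVec_of_isometry hU.1,
    mulVec_mulVec] at hbound
  exact hbound
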